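/- There is a universal constant $C>0$ such that the following holds. Let $(\Omega,\mathcal F,P)$ be a probability space, $B\ge 0$, $X:\Omega\to[-B,B]$ measurable, $\alpha\in(0,1]$ and $\tau\ge 0$. Let $\phi:\mathbb R\to[0,+\infty]$ be the convex indicator of $[0,1/\alpha]$, that is, $\phi(x)=0$ if $0\le x\le 1/\alpha$ and $\phi(x)=+\infty$ otherwise. For a probability measure $Q$ on $(\Omega,\mathcal F)$ put $$\mathcal R^Q(X)=\sup\Big\{\int X\zeta\,dQ:\ \zeta\ge 0 \text{ measurable},\ \int\zeta\,dQ=1,\ \int\phi(\zeta)\,dQ\le\tau\Big\},$$ and let $\mathcal R(X)=\mathcal R^P(X)$. Then $$\mathcal R(X)=\mathrm{CVaR}_\alpha(X):=\inf_{t\in\mathbb R}\Big\{t+\tfrac1\alpha\,\mathbb E_P\big[\max(X-t,0)\big]\Big\}.$$ Moreover, for $n\ge 1$ let $\omega_1,\dots,\omega_n$ be drawn independently from $P$, let $P_n=\frac1n\sum_{i=1}^n\delta_{\omega_i}$, and let $\mathcal R_n(X)=\mathcal R^{P_n}(X)$ be the sample average approximation (SAA) of $\mathcal R(X)$. Then for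 all $\varepsilon>0$ and $\delta\in(0,1)$, if $$n\ \ge\ C\Big(\frac{B^2}{\alpha\varepsilon^2}+\frac{B}{\alpha\varepsilon}\Big)\log\Big(2+\frac{B}{\alpha\varepsilon\delta}\Big),$$ then $|\mathcal R(X)-\mathcal R_n(X)|\le\varepsilon$ with probability at least $1-\delta$. In particular $\tilde{\mathcal O}\big(\frac{B^2}{\alpha\varepsilon^2}+\frac{B}{\alpha\varepsilon}\big)$ samples suffice, independently of $P$. -/

import Mathlib

universe u

open MeasureTheory
open scoped ENNReal

noncomputable section

namespace PhiDivergence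

/-- `ζ` is a probability density function with respect to `P`. -/
structure IsDensity {Ω : Type*} [MeasurableSpace Ω] (P : Measure Ω) (ζ : Ω → ℝ) : Prop where
  measurable : Measurable ζ
  nonneg : ∀ ω, 0 ≤ ζ ω
  lintegral_eq_one : ∫⁻ ω, ENNReal.ofReal (ζ ω) ∂P = 1

/-- The `φ`-divergence ball of radius `τ` around `P`: the densities `ζ` with respect to `P` such
that `∫ φ(ζ) dP ≤ τ`. The divergence function takes values in `[0, +∞]`. -/
def divergenceBall {Ω : Type*} [MeasurableSpace Ω] (P : Measure Ω) (φ : ℝ → ℝ≥0∞) (τ : ℝ) :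
    Set (Ω → ℝ) :=
  {ζ | IsDensity P ζ ∧ ∫⁻ ω, φ (ζ ω) ∂P ≤ ENNReal.ofReal τ}

/-- The distributionally robust functional: the supremum of `∫ X ζ dP` over the densities `ζ` in
the `φ`-divergence ball of radius `τ` around `P`. -/
def risk {Ω : Type*} [MeasurableSpace Ω] (P : Measure Ω) (φ : ℝ → ℝ≥0∞) (τ : ℝ) (X : Ω → ℝ) : ℝ :=
  sSup ((fun ζ : Ω → ℝ => ∫ ω, X ω * ζ ω ∂P) '' divergenceBall P φ τ)

/-- The empirical distribution of the sample `s 0, …, s (n - 1)`. -/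
def empirical {Ω : Type*} [MeasurableSpace Ω] {n : ℕ} (s : Fin n → Ω) : Measure Ω :=
  (n : ℝ≥0∞)⁻¹ • ∑ i, Measure.dirac (s i)

/-- The sample average approximation: the distributionally robust functional of the empirical
distribution. -/
def saaRisk {Ω : Type*} [MeasurableSpace Ω] {n : ℕ} (s : Fin n → Ω) (φ : ℝ → ℝ≥0∞) (τ : ℝ)
    (X : Ω → ℝ) : ℝ :=
  risk (empirical s) φ τ X

open Classical in
/-- The indicator (in the sense of convex analysis) of `[0, 1/α]`: zero on the interval and `+∞`
off it. -/
def cvarDivergence (α : ℝ) (x : ℝ) : ℝ≥0∞ :=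
  if x ∈ Set.Icc 0 (1 / α) then 0 else ⊤

/-- The conditional value-at-risk at level `α` (the mean of the upper `α`-tail), by its standard
variational formula. -/
def cvar {Ω : Type*} [MeasurableSpace Ω] (P : Measure Ω) (α : ℝ) (X : Ω → ℝ) : ℝ :=
  ⨅ t : ℝ, t + 1 / α * ∫ ω, max (X ω - t) 0 ∂P

end PhiDivergence

end

namespace PhiDivergence

open ProbabilityTheory Filter

/-! The value at `P` is attained at once by a threshold `t` (an upper `α`-quantile) and by a density
`ζ ≤ 1/α` concentrated on `{X ≥ t}` (`exists_optimal_pair`); weak duality then identifies the risk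
with CVaR. This pair, fixed before sampling, also controls the empirical value, so no uniform bound
over thresholds or densities is needed. The threshold `t` bounds it above. The function `ζ` bounds
it below, although its empirical mass need not be one: `min_le_objective` pays for the defect. Three
one-sided empirical means therefore suffice (`abs_cvar_sub_cvar_le`). Each of the three variables is
at most `2B/α` in absolute value but has second moment at most `4B²/α`, because `P(X > t) ≤ α` and
`ζ² ≤ ζ/α`. Bernstein's method thus costs only one factor `1/α`. -/

/-! ### Quantiles and the optimal primal-dual pair. -/

lemma exists_upper_quantile {Ω : Type*} [MeasurableSpace Ω] (P : Measure Ω)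
    [IsProbabilityMeasure P] {X : Ω → ℝ} {B α : ℝ} (hX : Measurable X)
    (hXB : ∀ ω, X ω ∈ Set.Icc (-B) B) (hα : 0 < α) (hα1 : α ≤ 1) :
    ∃ t ∈ Set.Icc (-B) B, P.real {ω | t < X ω} ≤ α ∧ α ≤ P.real {ω | t ≤ X ω} := by
  have : Nonempty Ω := nonempty_of_isProbabilityMeasure P
  obtain ⟨ω₀⟩ := this
  have hB : -B ≤ B := (hXB ω₀).1.trans (hXB ω₀).2
  -- The quantile is `sInf S`: continuity of `P` along increasing sets gives the strict tail bound,
  -- along decreasing sets the weak one.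
  set S : Set ℝ := {t | t ∈ Set.Icc (-B) B ∧ P.real {ω | t < X ω} ≤ α} with hS
  have hBS : B ∈ S := by
    refine ⟨⟨hB, le_rfl⟩, ?_⟩
    have : {ω | B < X ω} = ∅ := by
      ext ω; simpa using (hXB ω).2
    simp [this, hα.le]
  have hbdd : BddBelow S := ⟨-B, fun t ht => ht.1.1⟩
  have hmem : sInf S ∈ Set.Icc (-B) B :=
    ⟨le_csInf ⟨B, hBS⟩ fun t ht => ht.1.1, csInf_le hbdd hBS⟩
  have hle : ∀ {c : ℝ} {A : Set Ω}, 0 ≤ c → (P.real A ≤ c ↔ P A ≤ ENNReal.ofReal c) := by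
    intro c A hc
    rw [Measure.real, ENNReal.le_ofReal_iff_toReal_le (measure_ne_top _ _) hc]
  refine ⟨sInf S, hmem, ?_, ?_⟩
  · obtain ⟨u, hu, hut, hlim⟩ := exists_seq_strictAnti_tendsto (sInf S)
    have hun : {ω | sInf S < X ω} = ⋃ n, {ω | u n < X ω} := by
      ext ω
      simp only [Set.mem_ofPred_eq, Set.mem_iUnion]
      exact ⟨fun h => (hlim.eventually (gt_mem_nhds h)).exists,
        fun ⟨n, hn⟩ => (hut n).trans hn⟩
    have hmono : Monotone fun n => {ω | u n < X ω} := fun m n hmn ω (hω : u m < X ω) =>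
      (hu.antitone hmn).trans_lt hω
    rw [hle hα.le, hun, hmono.measure_iUnion]
    refine iSup_le fun n => (hle hα.le).1 ?_
    obtain ⟨t, ht, htu⟩ := exists_lt_of_csInf_lt ⟨B, hBS⟩ (hut n)
    exact (measureReal_mono fun ω (hω : u n < X ω) => htu.trans hω).trans ht.2
  · rcases hmem.1.eq_or_lt with h | h
    · have : {ω | sInf S ≤ X ω} = Set.univ := by
        ext ω; simpa [← h] using (hXB ω).1
      simpa [this] using hα1
    · obtain ⟨u, hu, hut, hlim⟩ := exists_seq_strictMono_tendsto' h
      have hin : {ω | sInf S ≤ X ω} = ⋂ n, {ω | u n < X ω} := by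
        ext ω
        simp only [Set.mem_ofPred_eq, Set.mem_iInter]
        exact ⟨fun h n => (hut n).2.trans_le h, fun h => le_of_tendsto' hlim fun n => (h n).le⟩
      have hanti : Antitone fun n => {ω | u n < X ω} := fun m n hmn ω (hω : u n < X ω) =>
        (hu.monotone hmn).trans_lt hω
      have : ENNReal.ofReal α ≤ P {ω | sInf S ≤ X ω} := by
        rw [hin, hanti.measure_iInter
          (fun n => (measurableSet_lt measurable_const hX).nullMeasurableSet)
          ⟨0, measure_ne_top _ _⟩]
        refine le_iInf fun n => ?_
        by_contra hcon
        have hn : u n ∈ S := ⟨⟨(hut n).1.le, (hut n).2.le.trans hmem.2⟩,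
          (hle hα.le).2 (not_le.1 hcon).le⟩
        exact (csInf_le hbdd hn).not_gt (hut n).2
      exact (ENNReal.ofReal_le_iff_le_toReal (measure_ne_top _ _)).1 this

lemma integrable_of_bounded {Ω : Type*} [MeasurableSpace Ω] (P : Measure Ω)
    [IsFiniteMeasure P] {f : Ω → ℝ} {c : ℝ} (hf : Measurable f) (hc : ∀ ω, |f ω| ≤ c) :
    Integrable f P :=
  Integrable.of_bound hf.aestronglyMeasurable c (ae_of_all _ hc)

/-- The variational objective of `cvar` has an optimal primal and dual pair. -/
lemma exists_optimal_pair {Ω : Type*} [MeasurableSpace Ω] (P : Measure Ω)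
    [IsProbabilityMeasure P] {X : Ω → ℝ} {B α : ℝ} (hX : Measurable X)
    (hXB : ∀ ω, X ω ∈ Set.Icc (-B) B) (hα : 0 < α) (hα1 : α ≤ 1) :
    ∃ t ∈ Set.Icc (-B) B, P.real {ω | t < X ω} ≤ α ∧ ∃ ζ : Ω → ℝ, Measurable ζ ∧
      (∀ ω, 0 ≤ ζ ω) ∧ (∀ ω, ζ ω ≤ 1 / α) ∧ ∫ ω, ζ ω ∂P = 1 ∧
      ∫ ω, X ω * ζ ω ∂P = t + 1 / α * ∫ ω, max (X ω - t) 0 ∂P := by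
  obtain ⟨t, ht, h1, h2⟩ := exists_upper_quantile P hX hXB hα hα1
  refine ⟨t, ht, h1, ?_⟩
  have hU : MeasurableSet {ω | t < X ω} := measurableSet_lt measurable_const hX
  have hE : MeasurableSet {ω | X ω = t} := hX (measurableSet_singleton t)
  set p := P.real {ω | t < X ω} with hp
  set q := P.real {ω | X ω = t} with hq
  have hpq : α ≤ p + q := by
    refine h2.trans ((measureReal_mono ?_).trans (measureReal_union_le _ _))
    intro ω (hω : t ≤ X ω)
    rcases hω.eq_or_lt with h | h
    · exact Or.inr h.symm
    · exact Or.inl h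
  have hq0 : 0 ≤ q := measureReal_nonneg
  have hp0 : 0 ≤ p := measureReal_nonneg
  -- The mass left over by `{X > t}` is spread over the atom `{X = t}`. If `q = 0` then `p = α`, and
  -- the value `c = 0` given by division by zero is the right one.
  set c := (1 - p / α) / q with hc
  have hcq : c * q = 1 - p / α := by
    rcases hq0.eq_or_lt with h | h
    · have : p = α := by linarith
      rw [← h, this, div_self hα.ne']; simp
    · rw [hc]; field_simp
  have hpα : p / α ≤ 1 := (div_le_one hα).2 h1
  have hc0 : 0 ≤ c := div_nonneg (by linarith) hq0
  have hcα : c ≤ 1 / α := by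
    rcases hq0.eq_or_lt with h | h
    · rw [hc, ← h]; simp [hα.le]
    · rw [hc, div_le_div_iff₀ h hα, sub_mul, div_mul_cancel₀ _ hα.ne']; linarith
  set ζ : Ω → ℝ := fun ω => {ω | t < X ω}.indicator (fun _ => 1 / α) ω
    + {ω | X ω = t}.indicator (fun _ => c) ω with hζ
  have hm : Measurable ζ :=
    (measurable_const.indicator hU).add (measurable_const.indicator hE)
  have hα' : 0 ≤ 1 / α := by positivity
  have hcases : ∀ ω, (t < X ω ∧ ζ ω = 1 / α) ∨ (X ω = t ∧ ζ ω = c) ∨ (X ω < t ∧ ζ ω = 0) := by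
    intro ω
    rcases lt_trichotomy t (X ω) with h | h | h
    · exact Or.inl ⟨h, by simp [hζ, h, h.ne']⟩
    · exact Or.inr (Or.inl ⟨h.symm, by simp [hζ, h]⟩)
    · exact Or.inr (Or.inr ⟨h, by simp [hζ, h.le.not_gt, h.ne]⟩)
  have h0 : ∀ ω, 0 ≤ ζ ω := fun ω => by
    rcases hcases ω with h | h | h <;> rw [h.2] <;> assumption_mod_cast
  have hle : ∀ ω, ζ ω ≤ 1 / α := fun ω => by
    rcases hcases ω with h | h | h <;> rw [h.2] <;> first | exact le_rfl | assumption
  have hint : ∫ ω, ζ ω ∂P = 1 := by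
    rw [hζ, integral_add ((integrable_const _).indicator hU) ((integrable_const _).indicator hE),
      integral_indicator_const _ hU, integral_indicator_const _ hE]
    simp only [smul_eq_mul, ← hp, ← hq]
    rw [mul_comm q, hcq]; ring
  refine ⟨ζ, hm, h0, hle, hint, ?_⟩
  have hpt : ∀ ω, X ω * ζ ω = t * ζ ω + 1 / α * max (X ω - t) 0 := fun ω => by
    rcases hcases ω with h | h | h
    · rw [h.2, max_eq_left (by linarith)]; ring
    · rw [h.1]; simp
    · rw [h.2, max_eq_right (by linarith)]; simp
  have hiζ : Integrable ζ P := integrable_of_bounded P hm (c := 1 / α) fun ω => by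
    rw [abs_of_nonneg (h0 ω)]; exact hle ω
  have hiX : Integrable (fun ω => max (X ω - t) 0) P :=
    ((integrable_of_bounded P hX fun ω => abs_le.2 (hXB ω)).sub (integrable_const t)).pos_part
  simp_rw [hpt]
  rw [integral_add (hiζ.const_mul t) (hiX.const_mul _), integral_const_mul, integral_const_mul,
    hint, mul_one]

/-! ### Weak duality without normalisation. -/

/-- A weak duality bound for functions `ζ` whose integral need not be one. -/
lemma min_le_objective {Ω : Type*} [MeasurableSpace Ω] (P : Measure Ω)
    [IsProbabilityMeasure P] {X ζ : Ω → ℝ} {B α : ℝ} (hX : Measurable X)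
    (hXB : ∀ ω, X ω ∈ Set.Icc (-B) B) (hα : 0 < α) (hα1 : α ≤ 1) (hζ : Measurable ζ)
    (h0 : ∀ ω, 0 ≤ ζ ω) (hle : ∀ᵐ ω ∂P, ζ ω ≤ 1 / α) (t : ℝ) :
    min (B + ∫ ω, (X ω - B) * ζ ω ∂P) (-B + ∫ ω, (X ω + B) * ζ ω ∂P)
      ≤ t + 1 / α * ∫ ω, max (X ω - t) 0 ∂P := by
  have hX_int : Integrable X P := integrable_of_bounded P hX fun ω => abs_le.2 (hXB ω)
  have hζ_int : Integrable ζ P := Integrable.of_bound hζ.aestronglyMeasurable (1 / α) <| by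
    filter_upwards [hle] with ω hω
    rwa [Real.norm_of_nonneg (h0 ω)]
  have hXζ : Integrable (fun ω => X ω * ζ ω) P :=
    hζ_int.bdd_mul hX.aestronglyMeasurable (c := B) (ae_of_all _ fun ω => abs_le.2 (hXB ω))
  have hα' : 0 ≤ 1 / α := by positivity
  have hα1' : 1 ≤ 1 / α := by rwa [le_div_iff₀ hα, one_mul]
  have hpos : Integrable (fun ω => max (X ω - t) 0) P :=
    (hX_int.sub (integrable_const t)).pos_part
  have hlin : ∀ c : ℝ, Integrable (fun ω => (X ω - c) * ζ ω) P ∧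
      ∫ ω, (X ω - c) * ζ ω ∂P = ∫ ω, X ω * ζ ω ∂P - c * ∫ ω, ζ ω ∂P := fun c => by
    simp_rw [sub_mul]
    exact ⟨hXζ.sub (hζ_int.const_mul c),
      by rw [integral_sub hXζ (hζ_int.const_mul c), integral_const_mul]⟩
  rcases lt_or_ge B t with ht | ht
  · refine (min_le_left _ _).trans ?_
    have h1 : ∫ ω, (X ω - B) * ζ ω ∂P ≤ 0 := integral_nonpos fun ω =>
      mul_nonpos_of_nonpos_of_nonneg (by have := (hXB ω).2; linarith) (h0 ω)
    have h2 : 0 ≤ 1 / α * ∫ ω, max (X ω - t) 0 ∂P :=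
      mul_nonneg hα' (integral_nonneg fun ω => le_max_right _ _)
    linarith
  rcases lt_or_ge t (-B) with ht' | ht'
  · refine (min_le_right _ _).trans ?_
    have h1 : ∫ ω, max (X ω - t) 0 ∂P = ∫ ω, (X ω + B) ∂P + (-B - t) := by
      rw [show -B - t = ∫ _, (-B - t) ∂P by simp,
        ← integral_add (f := fun ω => X ω + B) (hX_int.add (integrable_const B))
        (integrable_const _)]
      refine integral_congr_ae (ae_of_all _ fun ω => ?_)
      have := (hXB ω).1
      simp only
      rw [max_eq_left (by linarith)]; ring
    have h2 : ∫ ω, (X ω + B) * ζ ω ∂P ≤ 1 / α * ∫ ω, (X ω + B) ∂P := by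
      rw [← integral_const_mul]
      refine integral_mono_ae (by simpa using (hlin (-B)).1)
        ((hX_int.add (integrable_const B)).const_mul _) ?_
      filter_upwards [hle] with ω hω
      have := (hXB ω).1
      nlinarith
    rw [h1]
    nlinarith
  · have h1 : ∫ ω, (X ω - t) * ζ ω ∂P ≤ 1 / α * ∫ ω, max (X ω - t) 0 ∂P := by
      rw [← integral_const_mul]
      refine integral_mono_ae (hlin t).1 (hpos.const_mul _) ?_
      filter_upwards [hle] with ω hω
      calc (X ω - t) * ζ ω ≤ max (X ω - t) 0 * ζ ω :=
            mul_le_mul_of_nonneg_right (le_max_left _ _) (h0 ω)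
        _ ≤ max (X ω - t) 0 * (1 / α) := mul_le_mul_of_nonneg_left hω (le_max_right _ _)
        _ = _ := mul_comm _ _
    have h2 := (hlin B).2
    have h3 := (hlin (-B)).2
    simp only [sub_neg_eq_add] at h3
    rw [(hlin t).2] at h1
    rw [h2, h3]
    -- With `m = ∫ ζ`, the objective is at least `t(1 - m) + ∫ Xζ`. The sign of `1 - m` decides
    -- which end of `[-B, B]` replaces `t`; the loss is `B|1 - m|`.
    rcases le_total (∫ ω, ζ ω ∂P) 1 with hm | hm
    · refine (min_le_right _ _).trans ?_
      nlinarith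
    · refine (min_le_left _ _).trans ?_
      nlinarith

/-! ### The risk as conditional value-at-risk. -/

lemma IsDensity.integral_eq_one {Ω : Type*} [MeasurableSpace Ω] {P : Measure Ω} {ζ : Ω → ℝ}
    (h : IsDensity P ζ) : ∫ ω, ζ ω ∂P = 1 := by
  rw [integral_eq_lintegral_of_nonneg_ae (ae_of_all _ h.nonneg)
    h.measurable.aestronglyMeasurable, h.lintegral_eq_one, ENNReal.toReal_one]

/-- The divergence integral is `0` or `⊤`, so every finite radius gives the same ball. -/
lemma mem_divergenceBall_cvarDivergence_iff {Ω : Type*} [MeasurableSpace Ω] {P : Measure Ω}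
    {α τ : ℝ} {ζ : Ω → ℝ} :
    ζ ∈ divergenceBall P (cvarDivergence α) τ ↔ IsDensity P ζ ∧ ∀ᵐ ω ∂P, ζ ω ≤ 1 / α := by
  refine and_congr_right fun hζ => ⟨fun h => ?_, fun h => ?_⟩
  · have hm : Measurable (cvarDivergence α) :=
      Measurable.ite measurableSet_Icc measurable_const measurable_const
    filter_upwards [ae_lt_top (hm.comp hζ.measurable) (h.trans_lt ENNReal.ofReal_lt_top).ne]
      with ω hω
    by_contra hcon
    have hmem : ζ ω ∉ Set.Icc 0 (1 / α) := fun h => hcon h.2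
    exact hω.ne (if_neg hmem)
  · have : ∫⁻ ω, cvarDivergence α (ζ ω) ∂P = 0 := by
      rw [← lintegral_zero (μ := P)]
      refine lintegral_congr_ae ?_
      filter_upwards [h] with ω hω
      exact if_pos ⟨hζ.nonneg ω, hω⟩
    rw [this]
    exact zero_le

lemma cvar_le {Ω : Type*} [MeasurableSpace Ω] (P : Measure Ω)
    [IsProbabilityMeasure P] {X : Ω → ℝ} {B α : ℝ} (hX : Measurable X)
    (hXB : ∀ ω, X ω ∈ Set.Icc (-B) B) (hα : 0 < α) (hα1 : α ≤ 1) (t : ℝ) :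
    cvar P α X ≤ t + 1 / α * ∫ ω, max (X ω - t) 0 ∂P := by
  -- A real infimum needs a lower bound; weak duality with `ζ = 0` supplies one.
  refine ciInf_le ⟨min (B + ∫ ω, (X ω - B) * (0 : Ω → ℝ) ω ∂P)
    (-B + ∫ ω, (X ω + B) * (0 : Ω → ℝ) ω ∂P), ?_⟩ t
  rintro _ ⟨t, rfl⟩
  exact min_le_objective P hX hXB hα hα1 (ζ := 0) measurable_zero (fun _ => le_rfl)
    (ae_of_all _ fun _ => by simp [hα.le]) t

/-- Weak duality. -/
lemma integral_mul_le_cvar {Ω : Type*} [MeasurableSpace Ω] (P : Measure Ω)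
    [IsProbabilityMeasure P] {X ζ : Ω → ℝ} {B α : ℝ} (hX : Measurable X)
    (hXB : ∀ ω, X ω ∈ Set.Icc (-B) B) (hα : 0 < α) (hα1 : α ≤ 1) (hζ : Measurable ζ)
    (h0 : ∀ ω, 0 ≤ ζ ω) (hle : ∀ᵐ ω ∂P, ζ ω ≤ 1 / α) (hint : ∫ ω, ζ ω ∂P = 1) :
    ∫ ω, X ω * ζ ω ∂P ≤ cvar P α X ∧
      ∫ ω, (X ω - B) * ζ ω ∂P = ∫ ω, X ω * ζ ω ∂P - B ∧
      ∫ ω, (X ω + B) * ζ ω ∂P = ∫ ω, X ω * ζ ω ∂P + B := by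
  have hζ_int : Integrable ζ P := by
    by_contra h
    simp [integral_undef h] at hint
  have hXζ : Integrable (fun ω => X ω * ζ ω) P :=
    hζ_int.bdd_mul hX.aestronglyMeasurable (c := B) (ae_of_all _ fun ω => abs_le.2 (hXB ω))
  have h1 : ∫ ω, (X ω - B) * ζ ω ∂P = ∫ ω, X ω * ζ ω ∂P - B := by
    simp_rw [sub_mul]
    rw [integral_sub hXζ (hζ_int.const_mul B), integral_const_mul, hint, mul_one]
  have h2 : ∫ ω, (X ω + B) * ζ ω ∂P = ∫ ω, X ω * ζ ω ∂P + B := by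
    simp_rw [add_mul]
    rw [integral_add hXζ (hζ_int.const_mul B), integral_const_mul, hint, mul_one]
  refine ⟨le_ciInf fun t => ?_, h1, h2⟩
  have := min_le_objective P hX hXB hα hα1 hζ h0 hle t
  rw [h1, h2] at this
  simpa using this

lemma risk_eq_cvar {Ω : Type*} [MeasurableSpace Ω] (P : Measure Ω)
    [IsProbabilityMeasure P] {X : Ω → ℝ} {B α τ : ℝ} (hX : Measurable X)
    (hXB : ∀ ω, X ω ∈ Set.Icc (-B) B) (hα : 0 < α) (hα1 : α ≤ 1) :
    risk P (cvarDivergence α) τ X = cvar P α X := by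
  obtain ⟨t, -, -, ζ, hζ, h0, hle, hint, hopt⟩ := exists_optimal_pair P hX hXB hα hα1
  have hdens : IsDensity P ζ := by
    refine ⟨hζ, h0, ?_⟩
    rw [← ofReal_integral_eq_lintegral_ofReal _ (ae_of_all _ h0), hint, ENNReal.ofReal_one]
    by_contra h
    simp [integral_undef h] at hint
  refine IsGreatest.csSup_eq ⟨⟨ζ, mem_divergenceBall_cvarDivergence_iff.2
    ⟨hdens, ae_of_all _ hle⟩, ?_⟩, ?_⟩
  · exact le_antisymm (integral_mul_le_cvar P hX hXB hα hα1 hζ h0 (ae_of_all _ hle) hint).1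
      ((cvar_le P hX hXB hα hα1 t).trans_eq hopt.symm)
  · rintro _ ⟨ξ, hξ, rfl⟩
    obtain ⟨hξ, hξα⟩ := mem_divergenceBall_cvarDivergence_iff.1 hξ
    exact (integral_mul_le_cvar P hX hXB hα hα1 hξ.measurable hξ.nonneg hξα
      hξ.integral_eq_one).1

lemma abs_cvar_le {Ω : Type*} [MeasurableSpace Ω] (P : Measure Ω)
    [IsProbabilityMeasure P] {X : Ω → ℝ} {B α : ℝ} (hX : Measurable X)
    (hXB : ∀ ω, X ω ∈ Set.Icc (-B) B) (hα : 0 < α) (hα1 : α ≤ 1) :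
    |cvar P α X| ≤ B := by
  rw [abs_le]
  constructor
  · have h := (integral_mul_le_cvar P hX hXB hα hα1 (ζ := 1) measurable_const
      (fun _ => zero_le_one) (ae_of_all _ fun _ => by
        simpa using (one_le_inv₀ hα).2 hα1) (by simp)).1
    refine le_trans ?_ h
    have : ∫ _, -B ∂P ≤ ∫ ω, X ω * (1 : Ω → ℝ) ω ∂P := by
      simp only [Pi.one_apply, mul_one]
      exact integral_mono (integrable_const _)
        (integrable_of_bounded P hX fun ω => abs_le.2 (hXB ω)) fun ω => (hXB ω).1
    simpa using this
  · refine (cvar_le P hX hXB hα hα1 B).trans_eq ?_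
    have : ∀ ω, max (X ω - B) 0 = 0 := fun ω => max_eq_right (by have := (hXB ω).2; linarith)
    simp [this]

/-! ### Empirical means and Bernstein's method. -/

lemma isProbabilityMeasure_empirical {Ω : Type*} [MeasurableSpace Ω] {n : ℕ} (hn : 0 < n)
    (s : Fin n → Ω) : IsProbabilityMeasure (empirical s) := by
  constructor
  simp only [empirical, Measure.smul_apply, Measure.finsetSum_apply, measure_univ,
    Finset.sum_const, Finset.card_univ, Fintype.card_fin, smul_eq_mul, nsmul_eq_mul, mul_one]
  exact ENNReal.inv_mul_cancel (by exact_mod_cast hn.ne') (ENNReal.natCast_ne_top n)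

lemma integral_empirical {Ω : Type*} [MeasurableSpace Ω] {n : ℕ}
    (s : Fin n → Ω) {f : Ω → ℝ} (hf : Measurable f) :
    ∫ ω, f ω ∂(empirical s) = (n : ℝ)⁻¹ * ∑ i, f (s i) := by
  rw [empirical, integral_smul_measure, integral_finsetSum_measure]
  · simp [integral_dirac' _ _ hf.stronglyMeasurable]
  · intro i _
    exact integrable_dirac' hf.stronglyMeasurable (by simp)

/-- From `exp x ≤ 1 + x + x²` for `|x| ≤ 1`; the raw second moment suffices, so `Y` is not centred.
-/
lemma mgf_le_of_bounded {Ω : Type*} [MeasurableSpace Ω] (P : Measure Ω)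
    [IsProbabilityMeasure P] {Y : Ω → ℝ} {M v l : ℝ} (hY : Measurable Y)
    (hM : ∀ ω, |Y ω| ≤ M) (hv : ∫ ω, Y ω ^ 2 ∂P ≤ v) (hl : 0 ≤ l) (hlM : l * M ≤ 1) :
    ∫ ω, Real.exp (l * Y ω) ∂P ≤ Real.exp (l * ∫ ω, Y ω ∂P + l ^ 2 * v) := by
  have hi : Integrable Y P := integrable_of_bounded P hY hM
  have hi2 : Integrable (fun ω => Y ω ^ 2) P :=
    integrable_of_bounded P (hY.pow_const 2) (c := M ^ 2) fun ω => by
      rw [abs_pow]; exact pow_le_pow_left₀ (abs_nonneg _) (hM ω) 2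
  have hb : ∀ ω, |l * Y ω| ≤ 1 := fun ω => by
    rw [abs_mul, abs_of_nonneg hl]
    exact (mul_le_mul_of_nonneg_left (hM ω) hl).trans hlM
  have hle : ∀ ω, Real.exp (l * Y ω) ≤ 1 + l * Y ω + l ^ 2 * Y ω ^ 2 := fun ω => by
    have := (abs_le.1 (Real.abs_exp_sub_one_sub_id_le (hb ω))).2
    nlinarith
  have hi1 : Integrable (fun ω => 1 + l * Y ω) P := (integrable_const 1).add (hi.const_mul l)
  calc ∫ ω, Real.exp (l * Y ω) ∂P ≤ ∫ ω, (1 + l * Y ω + l ^ 2 * Y ω ^ 2) ∂P := by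
        refine integral_mono ?_ (hi1.add (hi2.const_mul _)) hle
        exact integrable_of_bounded P (hY.const_mul l).exp (c := Real.exp 1) fun ω => by
          rw [abs_of_pos (Real.exp_pos _)]
          exact Real.exp_le_exp.2 (abs_le.1 (hb ω)).2
    _ = 1 + l * ∫ ω, Y ω ∂P + l ^ 2 * ∫ ω, Y ω ^ 2 ∂P := by
        rw [integral_add hi1 (hi2.const_mul _), integral_add (integrable_const 1)
          (hi.const_mul l), integral_const_mul, integral_const_mul]
        simp
    _ ≤ (l * ∫ ω, Y ω ∂P + l ^ 2 * v) + 1 := by nlinarith [sq_nonneg l]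
    _ ≤ _ := Real.add_one_le_exp _

/-- A Bernstein-type upper tail bound for empirical means. -/
lemma measureReal_empirical_mean_ge_le {Ω : Type*} [MeasurableSpace Ω] (P : Measure Ω)
    [IsProbabilityMeasure P] {Y : Ω → ℝ} {M v l ε : ℝ} {n : ℕ} (hn : 0 < n) (hY : Measurable Y)
    (hM : ∀ ω, |Y ω| ≤ M) (hv : ∫ ω, Y ω ^ 2 ∂P ≤ v) (hl : 0 ≤ l) (hlM : l * M ≤ 1) :
    (Measure.pi (fun _ : Fin n => P)).real
      {s | ∫ ω, Y ω ∂P + ε ≤ ∫ ω, Y ω ∂(empirical s)}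
      ≤ Real.exp (-(n * (l * ε - l ^ 2 * v))) := by
  set Q := Measure.pi (fun _ : Fin n => P)
  have hset : {s : Fin n → Ω | ∫ ω, Y ω ∂P + ε ≤ ∫ ω, Y ω ∂(empirical s)}
      = {s | n * (∫ ω, Y ω ∂P + ε) ≤ ∑ i, Y (s i)} := by
    ext s
    have hn' : (0 : ℝ) < n := by exact_mod_cast hn
    rw [Set.mem_ofPred_eq, Set.mem_ofPred_eq, integral_empirical s hY, ← div_eq_inv_mul,
      le_div_iff₀ hn', mul_comm]
  have hmeas : Measurable fun s : Fin n → Ω => ∑ i, Y (s i) :=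
    Finset.measurable_sum _ fun i _ => hY.comp (measurable_pi_apply i)
  have hint : Integrable (fun s : Fin n → Ω => Real.exp (l * ∑ i, Y (s i))) Q :=
    integrable_of_bounded Q (hmeas.const_mul l).exp (c := Real.exp (l * (n * M))) fun s => by
      rw [abs_of_pos (Real.exp_pos _), Real.exp_le_exp]
      refine mul_le_mul_of_nonneg_left ?_ hl
      refine (Finset.sum_le_sum fun i _ => (abs_le.1 (hM (s i))).2).trans_eq ?_
      simp
  have hmgf : mgf (fun s : Fin n → Ω => ∑ i, Y (s i)) Q l
      ≤ Real.exp (l * ∫ ω, Y ω ∂P + l ^ 2 * v) ^ n := by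
    have : mgf (fun s : Fin n → Ω => ∑ i, Y (s i)) Q l = (∫ ω, Real.exp (l * Y ω) ∂P) ^ n := by
      simp only [mgf, Finset.mul_sum, Real.exp_sum]
      rw [integral_fintype_prod_eq_prod (fun (_ : Fin n) ω => Real.exp (l * Y ω))]
      simp
    rw [this]
    exact pow_le_pow_left₀ (integral_nonneg fun _ => (Real.exp_pos _).le)
      (mgf_le_of_bounded P hY hM hv hl hlM) n
  rw [hset]
  refine (measure_ge_le_exp_mul_mgf _ hl hint).trans ?_
  refine (mul_le_mul_of_nonneg_left hmgf (Real.exp_pos _).le).trans_eq ?_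
  rw [← Real.exp_nat_mul, ← Real.exp_add]
  congr 1
  ring

/-! ### Concentration of the empirical value. -/

/-- If three empirical means do not deviate from their expectations in one direction, then the
empirical conditional value-at-risk is close to the true one. -/
lemma abs_cvar_sub_cvar_le {Ω : Type*} [MeasurableSpace Ω] (P Q : Measure Ω)
    [IsProbabilityMeasure P] [IsProbabilityMeasure Q] {X ζ : Ω → ℝ} {B α ε t : ℝ}
    (hX : Measurable X) (hXB : ∀ ω, X ω ∈ Set.Icc (-B) B) (hα : 0 < α) (hα1 : α ≤ 1)
    (hζ : Measurable ζ) (h0 : ∀ ω, 0 ≤ ζ ω) (hle : ∀ ω, ζ ω ≤ 1 / α)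
    (hint : ∫ ω, ζ ω ∂P = 1)
    (hopt : ∫ ω, X ω * ζ ω ∂P = t + 1 / α * ∫ ω, max (X ω - t) 0 ∂P)
    (h1 : ∫ ω, 1 / α * max (X ω - t) 0 ∂Q ≤ ∫ ω, 1 / α * max (X ω - t) 0 ∂P + ε)
    (h2 : ∫ ω, -((X ω - B) * ζ ω) ∂Q ≤ ∫ ω, -((X ω - B) * ζ ω) ∂P + ε)
    (h3 : ∫ ω, -((X ω + B) * ζ ω) ∂Q ≤ ∫ ω, -((X ω + B) * ζ ω) ∂P + ε) :
    |cvar P α X - cvar Q α X| ≤ ε := by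
  obtain ⟨hdual, e1, e2⟩ :=
    integral_mul_le_cvar P hX hXB hα hα1 hζ h0 (ae_of_all _ hle) hint
  have hP := cvar_le P hX hXB hα hα1 t
  have hQ := cvar_le Q hX hXB hα hα1 t
  rw [integral_const_mul, integral_const_mul] at h1
  rw [integral_neg, integral_neg] at h2 h3
  have hQ' : ∫ ω, X ω * ζ ω ∂P - ε ≤ cvar Q α X := le_ciInf fun t' => by
    refine le_trans (le_min ?_ ?_)
      (min_le_objective Q hX hXB hα hα1 hζ h0 (ae_of_all _ hle) t') <;> linarith
  rw [abs_le]
  constructor <;> linarith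

/-- Since `ζ² ≤ ζ/α` and `ζ` has mass one, only one factor `1/α` is lost. -/
lemma integral_sq_mul_density_le {Ω : Type*} [MeasurableSpace Ω] (P : Measure Ω)
    [IsProbabilityMeasure P] {U ζ : Ω → ℝ} {B α : ℝ} (hU : ∀ ω, |U ω| ≤ 2 * B)
    (h0 : ∀ ω, 0 ≤ ζ ω) (hle : ∀ ω, ζ ω ≤ 1 / α)
    (hint : ∫ ω, ζ ω ∂P = 1) :
    ∫ ω, (-(U ω * ζ ω)) ^ 2 ∂P ≤ 4 * B ^ 2 / α := by
  have hζ_int : Integrable ζ P := by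
    by_contra h
    simp [integral_undef h] at hint
  have : ∫ ω, (-(U ω * ζ ω)) ^ 2 ∂P ≤ ∫ ω, 4 * B ^ 2 / α * ζ ω ∂P := by
    refine integral_mono_of_nonneg (ae_of_all _ fun ω => sq_nonneg _) (hζ_int.const_mul _)
      (ae_of_all _ fun ω => ?_)
    have h1 : U ω ^ 2 ≤ 4 * B ^ 2 := by
      rw [← sq_abs]
      exact (pow_le_pow_left₀ (abs_nonneg _) (hU ω) 2).trans_eq (by ring)
    calc (-(U ω * ζ ω)) ^ 2 = U ω ^ 2 * (ζ ω * ζ ω) := by ring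
      _ ≤ 4 * B ^ 2 * (1 / α * ζ ω) := mul_le_mul h1
          (mul_le_mul_of_nonneg_right (hle ω) (h0 ω)) (mul_self_nonneg _) (by positivity)
      _ = _ := by ring
  rwa [integral_const_mul, hint, mul_one] at this

lemma abs_mul_density_le {U z B α : ℝ} (hU : |U| ≤ 2 * B) (h0 : 0 ≤ z)
    (hle : z ≤ 1 / α) : |-(U * z)| ≤ 2 * B / α := by
  rw [abs_neg, abs_mul, abs_of_nonneg h0, div_eq_mul_one_div]
  exact mul_le_mul hU hle h0 ((abs_nonneg _).trans hU)

/-- The integrand is at most `4B²/α²` and vanishes off an event of probability at most `α`. -/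
lemma integral_sq_tail_le {Ω : Type*} [MeasurableSpace Ω] (P : Measure Ω)
    [IsProbabilityMeasure P] {X : Ω → ℝ} {B α t : ℝ} (hX : Measurable X)
    (hXB : ∀ ω, X ω ∈ Set.Icc (-B) B) (hα : 0 < α) (ht : t ∈ Set.Icc (-B) B)
    (hq : P.real {ω | t < X ω} ≤ α) :
    ∫ ω, (1 / α * max (X ω - t) 0) ^ 2 ∂P ≤ 4 * B ^ 2 / α := by
  have hU : MeasurableSet {ω | t < X ω} := measurableSet_lt measurable_const hX
  have : ∫ ω, (1 / α * max (X ω - t) 0) ^ 2 ∂P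
      ≤ ∫ ω, {ω | t < X ω}.indicator (fun _ => 4 * B ^ 2 / α ^ 2) ω ∂P := by
    refine integral_mono_of_nonneg (ae_of_all _ fun ω => sq_nonneg _)
      ((integrable_const _).indicator hU) (ae_of_all _ fun ω => ?_)
    by_cases h : t < X ω
    · have h1 : (X ω - t) ^ 2 ≤ 4 * B ^ 2 := by
        have := (hXB ω).2
        have := ht.1
        nlinarith
      simp only [Set.indicator_of_mem (show ω ∈ {ω | t < X ω} from h)]
      rw [max_eq_left (by linarith), mul_pow, div_pow, one_pow, one_div_mul_eq_div]
      gcongr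
    · have h' : X ω - t ≤ 0 := by linarith
      simp [h, max_eq_right h']
  refine this.trans ?_
  rw [integral_indicator_const _ hU, smul_eq_mul]
  calc _ ≤ α * (4 * B ^ 2 / α ^ 2) := mul_le_mul_of_nonneg_right hq (by positivity)
    _ = _ := by field_simp

/-- Tail bound for the sample average approximation of the conditional value-at-risk. -/
lemma measureReal_abs_cvar_sub_le {Ω : Type*} [MeasurableSpace Ω] (P : Measure Ω)
    [IsProbabilityMeasure P] {X : Ω → ℝ} {B α ε : ℝ} {n : ℕ} (hX : Measurable X)
    (hXB : ∀ ω, X ω ∈ Set.Icc (-B) B) (hα : 0 < α) (hα1 : α ≤ 1) (hε : 0 < ε)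
    (hεB : ε < 2 * B) (hn : 0 < n) :
    1 - 3 * Real.exp (-(n * (α * ε ^ 2 / (16 * B ^ 2)))) ≤
      (Measure.pi (fun _ : Fin n => P)).real
        {s | |cvar P α X - cvar (empirical s) α X| ≤ ε} := by
  obtain ⟨t, ht, hq, ζ, hζ, h0, hle, hint, hopt⟩ := exists_optimal_pair P hX hXB hα hα1
  have hB : 0 < B := by linarith
  have hα' : 0 < 1 / α := by positivity
  set Q := Measure.pi (fun _ : Fin n => P)
  have key : ∀ Y : Ω → ℝ, Measurable Y → (∀ ω, |Y ω| ≤ 2 * B / α) →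
      ∫ ω, Y ω ^ 2 ∂P ≤ 4 * B ^ 2 / α →
      Q.real {s | ∫ ω, Y ω ∂P + ε ≤ ∫ ω, Y ω ∂(empirical s)}
        ≤ Real.exp (-(n * (α * ε ^ 2 / (16 * B ^ 2)))) := fun Y hY hM hv => by
    -- This `l` maximises `lε - l²·4B²/α`; here `l·2B/α = ε/(4B) ≤ 1`.
    have := measureReal_empirical_mean_ge_le P (l := α * ε / (8 * B ^ 2)) (ε := ε) hn hY hM hv
      (by positivity) (by
        rw [div_mul_div_comm, div_le_one (by positivity)]
        have : 0 < α * B := by positivity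
        nlinarith)
    refine this.trans_eq ?_
    congr 3
    field_simp
    ring
  have hminus : ∀ ω, |X ω - B| ≤ 2 * B := fun ω => by
    have := hXB ω
    rw [abs_le]; constructor <;> linarith [this.1, this.2]
  have hplus : ∀ ω, |X ω + B| ≤ 2 * B := fun ω => by
    have := hXB ω
    rw [abs_le]; constructor <;> linarith [this.1, this.2]
  have k1 := key (fun ω => 1 / α * max (X ω - t) 0)
    (((hX.sub_const t).max measurable_const).const_mul _) (fun ω => by
      rw [abs_mul, abs_of_pos hα', abs_of_nonneg (le_max_right _ _), one_div_mul_eq_div]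
      have h1 := (hXB ω).2
      have h2 := ht.1
      gcongr
      exact max_le (by linarith) (by linarith))
    (integral_sq_tail_le P hX hXB hα ht hq)
  have k2 := key (fun ω => -((X ω - B) * ζ ω)) ((hX.sub_const B).mul hζ).neg
    (fun ω => abs_mul_density_le (hminus ω) (h0 ω) (hle ω))
    (integral_sq_mul_density_le P hminus h0 hle hint)
  have k3 := key (fun ω => -((X ω + B) * ζ ω)) ((hX.add_const B).mul hζ).neg
    (fun ω => abs_mul_density_le (hplus ω) (h0 ω) (hle ω))
    (integral_sq_mul_density_le P hplus h0 hle hint)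
  set G := {s : Fin n → Ω | |cvar P α X - cvar (empirical s) α X| ≤ ε}
  -- Covering the whole space uses only subadditivity, so measurability of `G` is not needed.
  have hcov : (Set.univ : Set (Fin n → Ω)) ⊆ G ∪ (
      {s | ∫ ω, 1 / α * max (X ω - t) 0 ∂P + ε ≤ ∫ ω, 1 / α * max (X ω - t) 0 ∂(empirical s)} ∪
      ({s | ∫ ω, -((X ω - B) * ζ ω) ∂P + ε ≤ ∫ ω, -((X ω - B) * ζ ω) ∂(empirical s)} ∪
      {s | ∫ ω, -((X ω + B) * ζ ω) ∂P + ε ≤ ∫ ω, -((X ω + B) * ζ ω) ∂(empirical s)})) := by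
    intro s _
    by_contra hs
    simp only [Set.mem_union, Set.mem_ofPred_eq, not_or, not_le] at hs
    obtain ⟨hG, hs1, hs2, hs3⟩ := hs
    have := isProbabilityMeasure_empirical hn s
    exact hG (abs_cvar_sub_cvar_le P (empirical s) hX hXB hα hα1 hζ h0 hle hint hopt
      hs1.le hs2.le hs3.le)
  have hone : Q.real Set.univ = 1 := by simp
  have := measureReal_mono (μ := Q) hcov
  rw [hone] at this
  have u1 := this.trans (measureReal_union_le _ _)
  have u2 := u1.trans (add_le_add_right (measureReal_union_le _ _) _)
  have u3 := measureReal_union_le (μ := Q)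
    {s | ∫ ω, -((X ω - B) * ζ ω) ∂P + ε ≤ ∫ ω, -((X ω - B) * ζ ω) ∂(empirical s)}
    {s | ∫ ω, -((X ω + B) * ζ ω) ∂P + ε ≤ ∫ ω, -((X ω + B) * ζ ω) ∂(empirical s)}
  linarith

/-! ### Sample size. -/

lemma three_mul_exp_le {B α ε δ N : ℝ} (hα : 0 < α) (hα1 : α ≤ 1) (hε : 0 < ε)
    (hεB : ε < 2 * B) (hδ : 0 < δ)
    (hN : 64 * (B ^ 2 / (α * ε ^ 2) + B / (α * ε)) * Real.log (2 + B / (α * ε * δ)) ≤ N) :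
    3 * Real.exp (-(N * (α * ε ^ 2 / (16 * B ^ 2)))) ≤ δ := by
  have hB : 0 < B := by linarith
  set y := B / (α * ε * δ) with hy
  have hyδ : 1 ≤ 2 * y * δ := by
    have : 2 * y * δ = 2 * B / (α * ε) := by rw [hy]; field_simp
    rw [this, one_le_div (by positivity)]
    nlinarith
  have hy0 : 0 < y := by positivity
  have hL : 0 < Real.log (2 + y) := Real.log_pos (by linarith)
  -- The constant is `64 = 4 · 16`. The power `(2 + y)^4 ≥ 6y`, with `2yδ ≥ 1`, absorbs the
  -- union-bound factor `3`.
  have h1 : 4 * Real.log (2 + y) ≤ N * (α * ε ^ 2 / (16 * B ^ 2)) := by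
    have h2 : 64 * (B ^ 2 / (α * ε ^ 2)) * Real.log (2 + y) ≤ N := by
      refine le_trans ?_ hN
      have : 0 < B / (α * ε) := by positivity
      gcongr
      linarith
    calc 4 * Real.log (2 + y)
        = 64 * (B ^ 2 / (α * ε ^ 2)) * Real.log (2 + y) * (α * ε ^ 2 / (16 * B ^ 2)) := by
          field_simp; norm_num
      _ ≤ _ := mul_le_mul_of_nonneg_right h2 (by positivity)
  have h3 : Real.exp (-(N * (α * ε ^ 2 / (16 * B ^ 2)))) ≤ ((2 + y) ^ 4)⁻¹ := by
    have : ((2 + y) ^ 4)⁻¹ = Real.exp (-(4 * Real.log (2 + y))) := by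
      rw [Real.exp_neg, mul_comm, Real.exp_mul, Real.exp_log (by linarith)]
      norm_cast
    rw [this, Real.exp_le_exp]
    linarith
  have h4 : 6 * y ≤ (2 + y) ^ 4 := by nlinarith [pow_pos hy0 2, pow_pos hy0 3, pow_pos hy0 4]
  have h5 : 3 ≤ δ * (2 + y) ^ 4 := by nlinarith
  calc _ ≤ 3 * ((2 + y) ^ 4)⁻¹ := by linarith
    _ ≤ δ := by rwa [← div_eq_mul_inv, div_le_iff₀ (by positivity)]

end PhiDivergence

theorem mainTheorem10 :
    ∃ C : ℝ, 0 < C ∧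
      ∀ (Ω : Type u) [MeasurableSpace Ω] (P : Measure Ω) [IsProbabilityMeasure P]
        (X : Ω → ℝ) (B α τ : ℝ),
        Measurable X → (∀ ω, X ω ∈ Set.Icc (-B) B) → 0 ≤ B → 0 < α → α ≤ 1 → 0 ≤ τ →
        PhiDivergence.risk P (PhiDivergence.cvarDivergence α) τ X = PhiDivergence.cvar P α X ∧
        ∀ (ε δ : ℝ) (n : ℕ), 0 < ε → 0 < δ → δ < 1 → 0 < n →
          C * (B ^ 2 / (α * ε ^ 2) + B / (α * ε)) * Real.log (2 + B / (α * ε * δ)) ≤ (n : ℝ) →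
          1 - δ ≤ (Measure.pi (fun _ : Fin n => P)).real
            {s : Fin n → Ω |
              |PhiDivergence.risk P (PhiDivergence.cvarDivergence α) τ X
                - PhiDivergence.saaRisk s (PhiDivergence.cvarDivergence α) τ X| ≤ ε} := by
  refine ⟨64, by norm_num, fun Ω _ P _ X B α τ hX hXB hB hα hα1 _ =>
    ⟨PhiDivergence.risk_eq_cvar P hX hXB hα hα1, fun ε δ n hε hδ _ hn hN => ?_⟩⟩
  have hset : {s : Fin n → Ω |
      |PhiDivergence.risk P (PhiDivergence.cvarDivergence α) τ X
        - PhiDivergence.saaRisk s (PhiDivergence.cvarDivergence α) τ X| ≤ ε}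
      = {s | |PhiDivergence.cvar P α X
        - PhiDivergence.cvar (PhiDivergence.empirical s) α X| ≤ ε} := by
    ext s
    have := PhiDivergence.isProbabilityMeasure_empirical hn s
    rw [Set.mem_ofPred_eq, Set.mem_ofPred_eq, PhiDivergence.saaRisk,
      PhiDivergence.risk_eq_cvar P hX hXB hα hα1,
      PhiDivergence.risk_eq_cvar (PhiDivergence.empirical s) hX hXB hα hα1]
  rw [hset]
  rcases lt_or_ge ε (2 * B) with hεB | hεB
  · have h1 := PhiDivergence.measureReal_abs_cvar_sub_le P hX hXB hα hα1 hε hεB hn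
    have h2 := PhiDivergence.three_mul_exp_le hα hα1 hε hεB hδ hN
    linarith
  -- Both values lie in `[-B, B]`, so they differ by at most `2B ≤ ε`.
  · have huniv : {s : Fin n → Ω | |PhiDivergence.cvar P α X
        - PhiDivergence.cvar (PhiDivergence.empirical s) α X| ≤ ε} = Set.univ := by
      refine Set.eq_univ_of_forall fun s => ?_
      have := PhiDivergence.isProbabilityMeasure_empirical hn s
      have h1 := PhiDivergence.abs_cvar_le P hX hXB hα hα1
      have h2 := PhiDivergence.abs_cvar_le (PhiDivergence.empirical s) hX hXB hα hα1
      rw [abs_le] at h1 h2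
      rw [Set.mem_ofPred_eq, abs_le]
      constructor <;> linarith [h1.1, h1.2, h2.1, h2.2]
    rw [huniv]
    simpa using hδ.le
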